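/- Let $\mathbb F$ be a field. An algebra is an $\mathbb F$-vector space $A$ with a bilinear multiplication $A\times A\to A$, $(x,y)\mapsto xy$ (no further condition is imposed); morphisms are the linear maps preserving the multiplication. A variety $\mathcal V$ is the class (and full subcategory) of all algebras satisfying a given set of identities $\varphi(x_1,\dots,x_n)=0$, where the $\varphi$ are non-associative polynomials over $\mathbb F$; it is *operadic* if it can be determined by a set of multilinear polynomials, i.e. polynomials $\varphi(x_1,\dots,x_n)$ in each of whose monomials every $x_i$ occurs exactly once. A subvariety of a variety is a variety contained in it. For an object $X$ of $\mathcal V$, let $\mathbf{SplExt}(X)$ be the category whose objects are the split extensions $X\xrightarrow{k}A\underset{\beta}{\overset{\alpha}{\rightleftarrows}}B$ in $\mathcal V$ (that is, $\alpha\beta=1_B$ and $k$ is a kernel of $\alpha$), and whose morphisms $(A,B,k,\alpha,\beta)\to(A',B',k',\alpha',\beta')$ are the pairs $f\colon A\to A'$, $g\colon B\to B'$ with $fk=k'$, $g\alpha=\alpha' f$, $f\beta=\beta' g$. An object of $\mathbf{SplExt}(X)$ is *faithful* if every object has at most one morphism into it. $\mathcal V$ is *action accessible* if, for every $X$ in $\mathcal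 V$, every object of $\mathbf{SplExt}(X)$ has a morphism into a faithful object. Let $\mathcal V$ be an action accessible, operadic variety of algebras over $\mathbb F$ which is not the variety of abelian algebras (the one determined by $xy=0$). 1. If all algebras in $\mathcal V$ are commutative ($xy=yx$), then $\mathcal V$ is a subvariety of $\mathbf{CAssoc}$ or a subvariety of $\mathbf{JJord}$ (or of both). 2. If all algebras in $\mathcal V$ are anti-commutative ($xy=-yx$), then $\mathcal V$ is a subvariety of $\mathbf{Lie}$ or a subvariety of $\mathbf{ACAAssoc}$ (or of both). Here $\mathbf{CAssoc}$ is the variety of commutative associative algebras; $\mathbf{JJord}$ is determined by $xy=yx$ and the Jacobi identity $x(yz)+y(zx)+z(xy)=0$; $\mathbf{Lie}$ is determined by $xy+yx=0$ and the Jacobi identity; and $\mathbf{ACAAssoc}$ is determined by $xy=-yx$ and $x(yz)=-(xy)z$. -/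

import Mathlib

open CategoryTheory CategoryTheory.Limits

universe w v u

/-! ### Split extensions and action accessibility in a pointed category -/

/-- A split extension `X --k--> A --α--> B`, `β : B ⟶ A`, with fixed kernel object `X`:
`α ∘ β = 1` and `k` is a kernel of `α`. These are the objects of the category `SplExt(X)`. -/
structure SplitExtension {C : Type u} [Category.{v} C] [HasZeroMorphisms C] (X : C) where
  A : C
  B : C
  k : X ⟶ A
  α : A ⟶ B
  β : B ⟶ A
  section_proj : β ≫ α = 𝟙 B
  zero : k ≫ α = 0
  isKernel : Nonempty (IsLimit (KernelFork.ofι k zero))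

/-- Morphisms of `SplExt(X)`: morphisms of extensions that are the identity on `X` and
commute with the sections. -/
@[ext]
structure SplitExtension.Hom {C : Type u} [Category.{v} C] [HasZeroMorphisms C] {X : C}
    (E E' : SplitExtension X) where
  f : E.A ⟶ E'.A
  g : E.B ⟶ E'.B
  comm_k : E.k ≫ f = E'.k
  comm_α : E.α ≫ g = f ≫ E'.α
  comm_β : E.β ≫ f = g ≫ E'.β

/-- A split extension is faithful if it is subterminal in `SplExt(X)`: each split extension
with kernel `X` has at most one morphism into it. -/
def SplitExtension.IsFaithful {C : Type u} [Category.{v} C] [HasZeroMorphisms C] {X : C}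
    (E : SplitExtension X) : Prop :=
  ∀ E' : SplitExtension X, Subsingleton (SplitExtension.Hom E' E)

/-- A category is action accessible if, for each object `X`, every split extension with kernel `X`
has a morphism in `SplExt(X)` into a faithful one. -/
def IsActionAccessible (C : Type u) [Category.{v} C] [HasZeroMorphisms C] : Prop :=
  ∀ (X : C) (E : SplitExtension X),
    ∃ E' : SplitExtension X, E'.IsFaithful ∧ Nonempty (SplitExtension.Hom E E')

/-! ### The category of non-associative algebras -/

/-- Non-associative algebras over `F`: vector spaces with a bilinear multiplication. -/
structure NAAlg (F : Type u) [Field F] : Type (u + 1) where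
  carrier : Type u
  [ring : NonUnitalNonAssocRing carrier]
  [module : Module F carrier]
  [isScalarTower : IsScalarTower F carrier carrier]
  [smulCommClass : SMulCommClass F carrier carrier]

instance {F : Type u} [Field F] : CoeSort (NAAlg F) (Type u) := ⟨NAAlg.carrier⟩

attribute [instance] NAAlg.ring NAAlg.module NAAlg.isScalarTower NAAlg.smulCommClass

/-- Morphisms are the linear maps that preserve the multiplication. -/
instance {F : Type u} [Field F] : Category.{u} (NAAlg F) where
  Hom A B := A →ₙₐ[F] B
  id A := NonUnitalAlgHom.id F A
  comp f g := NonUnitalAlgHom.comp g f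

instance {F : Type u} [Field F] : HasZeroMorphisms (NAAlg F) where
  zero A B := ⟨(0 : A →ₙₐ[F] B)⟩
  comp_zero _ _ := rfl
  zero_comp _ Y Z f := NonUnitalAlgHom.ext fun _ => map_zero (show Y →ₙₐ[F] Z from f)

/-! ### Identities and varieties

`FreeNonUnitalNonAssocAlgebra F S` is the magma algebra over `F` of the free magma on `S`. -/

/-- The multiset of letters of a non-associative word, with multiplicities. -/
def FreeMagma.letters {S : Type w} : FreeMagma S → Multiset S
  | .of x => {x}
  | .mul a b => a.letters + b.letters

/-- A non-associative polynomial is multilinear if there is a finite set `{x₁, …, xₙ}` of variables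
such that in each of its monomials each of `x₁, …, xₙ` occurs exactly once and no other variable
occurs. -/
def IsMultilinear {F : Type u} [Field F] {S : Type w}
    (φ : FreeNonUnitalNonAssocAlgebra F S) : Prop :=
  ∃ s : Finset S, ∀ m ∈ φ.coeff.support, m.letters = s.val

/-- `φ` is an identity of `A`: it vanishes under every substitution of elements of `A` for the
variables. -/
def NAAlg.Satisfies {F : Type u} [Field F] {S : Type w} (A : NAAlg F)
    (φ : FreeNonUnitalNonAssocAlgebra F S) : Prop :=
  ∀ a : S → A, FreeNonUnitalNonAssocAlgebra.lift F a φ = 0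

/-- The variety determined by a set `I` of polynomials: the class of all algebras that satisfy
all identities in `I`. -/
def NAAlg.variety {F : Type u} [Field F] {S : Type w}
    (I : Set (FreeNonUnitalNonAssocAlgebra F S)) : ObjectProperty (NAAlg F) :=
  fun A => ∀ φ ∈ I, A.Satisfies φ

/-- A class of algebras is an operadic variety if it is the variety determined by some set of
multilinear polynomials. -/
def IsOperadicVariety {F : Type u} [Field F] (V : ObjectProperty (NAAlg F)) : Prop :=
  ∃ (S : Type w) (I : Set (FreeNonUnitalNonAssocAlgebra F S)),
    (∀ φ ∈ I, IsMultilinear φ) ∧ V = NAAlg.variety I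

/-! ### The varieties that occur in the statement

A variety is a subvariety of another one when it is contained in it, which is `≤`
on `ObjectProperty`. -/

/-- Abelian algebras: `xy = 0`. -/
def AbAlg (F : Type u) [Field F] : ObjectProperty (NAAlg F) :=
  fun A => ∀ x y : A, x * y = 0

/-- Commutative algebras: `xy = yx`. -/
def Com (F : Type u) [Field F] : ObjectProperty (NAAlg F) :=
  fun A => ∀ x y : A, x * y = y * x

/-- Anti-commutative algebras: `xy = -yx`. -/
def ACom (F : Type u) [Field F] : ObjectProperty (NAAlg F) :=
  fun A => ∀ x y : A, x * y = -(y * x)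

/-- Commutative associative algebras. -/
def CAssoc (F : Type u) [Field F] : ObjectProperty (NAAlg F) :=
  fun A => (∀ x y : A, x * y = y * x) ∧ ∀ x y z : A, x * (y * z) = (x * y) * z

/-- Jacobi–Jordan algebras: commutativity and the Jacobi identity. -/
def JJord (F : Type u) [Field F] : ObjectProperty (NAAlg F) :=
  fun A => (∀ x y : A, x * y = y * x) ∧
    ∀ x y z : A, x * (y * z) + y * (z * x) + z * (x * y) = 0

/-- Lie algebras, in the sense of anti-commutativity `xy + yx = 0` (not `xx = 0`) and the Jacobi
identity. -/
def LieVar (F : Type u) [Field F] : ObjectProperty (NAAlg F) :=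
  fun A => (∀ x y : A, x * y + y * x = 0) ∧
    ∀ x y z : A, x * (y * z) + y * (z * x) + z * (x * y) = 0

/-- Anti-commutative anti-associative algebras. -/
def ACAAssoc (F : Type u) [Field F] : ObjectProperty (NAAlg F) :=
  fun A => (∀ x y : A, x * y = -(y * x)) ∧ ∀ x y z : A, x * (y * z) = -((x * y) * z)

/-! An action accessible variety cannot contain a split extension `B ⋉ M` in which some `a : B` with
`a * a = 0` acts trivially on the abelian kernel `M` while a product `a * b` does not: in a morphism
to a faithful split extension, the inclusion of the line of `a` in `B` and the zero map, which both
extend to `⟨a⟩ ⋉ M ⟶ B ⋉ M`, have to become equal, so that `a`, hence also `a * b`, is sent to `0`.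

On the other hand, suppose that `x y = σ y x` holds in the variety and that `(a b) c` is not a
linear combination of `a (b c)` and `b (a c)` in one of its algebras `A`. An operadic variety is
closed under `A ↦ A[ε]` with `ε² = 0`. In `A[ε₁][ε₂][ε₃]` the elements `a ε₁`, `b ε₂`, `c ε₃`
multiply multilinearly, so that no relations hold between them except those between the words in
`a`, `b`, `c`; killing `a (b c)` and `b (a c)` but not `(a b) c` produces a forbidden split
extension.

Hence `(a b) c = s a (b c) + t b (a c)`, with `s` and `t` uniform because the variety is closed
under products. Rewritten as `(a b) c = s σ (b c) a + t (c a) b` and combined with its image under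
`a ↔ b` and with its cyclic rotations, this forces `(a b) c = (b c) a` or
`(a b) c + (b c) a + (c a) b = 0`. -/

namespace SplitExtension

variable {C : Type u} [Category.{v} C] [HasZeroMorphisms C] {X : C}

/-- Composition in the category `SplExt(X)`. -/
def Hom.comp {E₁ E₂ E₃ : SplitExtension X} (m : Hom E₁ E₂) (n : Hom E₂ E₃) : Hom E₁ E₃ where
  f := m.f ≫ n.f
  g := m.g ≫ n.g
  comm_k := by rw [← Category.assoc, m.comm_k, n.comm_k]
  comm_α := by rw [← Category.assoc, m.comm_α, Category.assoc, n.comm_α, Category.assoc]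
  comm_β := by rw [← Category.assoc, m.comm_β, Category.assoc, n.comm_β, Category.assoc]

theorem IsFaithful.comp_g_eq {E₁ E₂ E₃ : SplitExtension X} (hE₃ : E₃.IsFaithful)
    (m n : Hom E₁ E₂) (h : Hom E₂ E₃) : m.g ≫ h.g = n.g ≫ h.g :=
  congrArg Hom.g ((hE₃ E₁).elim (m.comp h) (n.comp h))

end SplitExtension

namespace NAAlg

variable {F : Type u} [Field F] {S : Type w}

theorem map_lift {A B : NAAlg F} (g : A →ₙₐ[F] B) (a : S → A)
    (φ : FreeNonUnitalNonAssocAlgebra F S) :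
    g (FreeNonUnitalNonAssocAlgebra.lift F a φ) =
      FreeNonUnitalNonAssocAlgebra.lift F (g ∘ a) φ := by
  have h : g.comp (FreeNonUnitalNonAssocAlgebra.lift F a) =
      FreeNonUnitalNonAssocAlgebra.lift F (g ∘ a) :=
    FreeNonUnitalNonAssocAlgebra.hom_ext F fun x => by simp
  exact DFunLike.congr_fun h φ

theorem lift_eq_sum (A : NAAlg F) (a : S → A) (φ : FreeNonUnitalNonAssocAlgebra F S) :
    FreeNonUnitalNonAssocAlgebra.lift F a φ =
      ∑ m ∈ φ.coeff.support, φ.coeff m • FreeMagma.lift a m := rfl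

theorem Satisfies.of_injective {A B : NAAlg F} {φ : FreeNonUnitalNonAssocAlgebra F S}
    (hB : B.Satisfies φ) (g : A →ₙₐ[F] B) (hg : Function.Injective g) : A.Satisfies φ :=
  fun a => hg (by rw [map_lift, hB, map_zero])

theorem Satisfies.of_surjective {A B : NAAlg F} {φ : FreeNonUnitalNonAssocAlgebra F S}
    (hA : A.Satisfies φ) (g : A →ₙₐ[F] B) (hg : Function.Surjective g) : B.Satisfies φ := by
  intro b
  obtain ⟨a, rfl⟩ := hg.comp_left b
  rw [← map_lift, hA, map_zero]

/-- A multiplicative linear map, as a homomorphism of algebras. -/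
def homOfLinearMap {A B : NAAlg F} (f : A →ₗ[F] B) (hf : ∀ x y, f (x * y) = f x * f y) :
    A →ₙₐ[F] B where
  toFun := f
  map_smul' := map_smul f
  map_zero' := map_zero f
  map_add' := map_add f
  map_mul' := hf

/-- The projection of a product of algebras to one of its factors. -/
def evalHom {ι : Type u} (A : ι → NAAlg F) (i : ι) : (⟨∀ i, A i⟩ : NAAlg F) →ₙₐ[F] A i :=
  homOfLinearMap (A := ⟨∀ i, A i⟩) (LinearMap.proj i) fun _ _ => rfl

theorem Satisfies.pi {ι : Type u} {A : ι → NAAlg F} {φ : FreeNonUnitalNonAssocAlgebra F S}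
    (hA : ∀ i, (A i).Satisfies φ) : (⟨∀ i, A i⟩ : NAAlg F).Satisfies φ :=
  fun a => funext fun i => (map_lift (evalHom A i) a φ).trans (hA i _)

/-- The algebra whose multiplication is the bilinear map `μ`. -/
def ofBilin {M : Type u} [AddCommGroup M] [Module F M] (μ : M →ₗ[F] M →ₗ[F] M) : NAAlg F :=
  letI ring : NonUnitalNonAssocRing M :=
    { (inferInstance : AddCommGroup M) with
      mul := fun x y => μ x y
      left_distrib := fun x => map_add (μ x)
      right_distrib := μ.map_add₂
      zero_mul := μ.map_zero₂
      mul_zero := fun x => map_zero (μ x) }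
  { carrier := M
    ring := ring
    module := (inferInstance : Module F M)
    isScalarTower := ⟨μ.map_smul₂⟩
    smulCommClass := ⟨fun r x y => (map_smul (μ x) r y).symm⟩ }

section Semidirect

variable {B : NAAlg F} {M : Type u} [AddCommGroup M] [Module F M]

/-- The split extension of `B` by the space `M` with zero multiplication: the algebra on `B × M`
with `(b, m) (b', m') = (b b', l b m' + r b' m)`. Both actions are curried with the element of `B`
first, so `r b' m` stands for the product `m b'`. -/
def semidirect (B : NAAlg F) (l r : B →ₗ[F] M →ₗ[F] M) : NAAlg F :=
  ofBilin (M := B × M) <| LinearMap.mk₂ F (fun x y => (x.1 * y.1, l x.1 y.2 + r y.1 x.2))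
    (fun _ _ _ => by ext <;> simp [add_mul]; abel)
    (fun _ _ _ => by ext <;> simp [smul_mul_assoc])
    (fun _ _ _ => by ext <;> simp [mul_add]; abel)
    (fun _ _ _ => by ext <;> simp [mul_smul_comm])

namespace semidirect

variable {l r : B →ₗ[F] M →ₗ[F] M}

/-- The projection of `B ⋉ M` onto the acting algebra. -/
def fst : B.semidirect l r →ₙₐ[F] B :=
  homOfLinearMap (A := B.semidirect l r) (LinearMap.fst F B M) fun _ _ => rfl

/-- The component of an element of `B ⋉ M` in the kernel. -/
def snd : B.semidirect l r →ₗ[F] M := LinearMap.snd F B M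

theorem snd_mul (x y : B.semidirect l r) :
    snd (x * y) = l (fst x) (snd y) + r (fst y) (snd x) := rfl

@[ext]
theorem ext {x y : B.semidirect l r} (h₁ : fst x = fst y) (h₂ : snd x = snd y) : x = y :=
  Prod.ext h₁ h₂

/-- The inclusion of the acting algebra in `B ⋉ M`. -/
def inl : B →ₙₐ[F] B.semidirect l r :=
  homOfLinearMap (B := B.semidirect l r) (LinearMap.inl F B M) fun b b' => by
    refine ext rfl ?_
    rw [snd_mul]
    change 0 = l b 0 + r b' 0
    simp

/-- The inclusion of the kernel in `B ⋉ M`. -/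
def inr : ofBilin (0 : M →ₗ[F] M →ₗ[F] M) →ₙₐ[F] B.semidirect l r :=
  homOfLinearMap (A := ofBilin 0) (B := B.semidirect l r) (LinearMap.inr F B M) fun m m' => by
    refine ext (zero_mul (0 : B)).symm ?_
    rw [snd_mul]
    change 0 = l 0 m' + r 0 m
    simp only [map_zero]
    exact (zero_add (0 : M)).symm

theorem inl_mul_inr (b : B) (m : M) :
    (inl b * inr m : B.semidirect l r) = inr (l b m) := by
  refine ext (mul_zero b) ?_
  change l b m + r 0 0 = l b m
  simp

/-- The homomorphism `B ⋉ M ⟶ B' ⋉ M'` given by a homomorphism of the acting algebras and an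
equivariant map of the kernels. -/
def map {B' : NAAlg F} {M' : Type u} [AddCommGroup M'] [Module F M']
    {l' r' : B' →ₗ[F] M' →ₗ[F] M'} (φ : B →ₙₐ[F] B') (g : M →ₗ[F] M')
    (hl : ∀ b m, g (l b m) = l' (φ b) (g m)) (hr : ∀ b m, g (r b m) = r' (φ b) (g m)) :
    B.semidirect l r →ₙₐ[F] B'.semidirect l' r' :=
  homOfLinearMap (A := B.semidirect l r) (B := B'.semidirect l' r')
    ((φ : B →ₗ[F] B').prodMap g) fun x y => by
      refine ext (map_mul φ (fst x) (fst y)) ?_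
      change g (snd (x * y)) = l' (φ (fst x)) (g (snd y)) + r' (φ (fst y)) (g (snd x))
      rw [snd_mul, map_add, hl, hr]

end semidirect

end Semidirect

/-- The algebra of dual numbers `A[ε]`, with `ε² = 0`. -/
abbrev dual (A : NAAlg F) : NAAlg F := A.semidirect (LinearMap.mul F A) (LinearMap.mul F A).flip

theorem lift_update_of_notMem [DecidableEq S] {A : NAAlg F} {i : S} (a : S → A) (c : A)
    (m : FreeMagma S) (hi : i ∉ m.letters) :
    FreeMagma.lift (Function.update a i c) m = FreeMagma.lift a m := by
  induction m with
  | ih1 x => exact Function.update_of_ne (by simpa [FreeMagma.letters, eq_comm] using hi) _ _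
  | ih2 m₁ m₂ ih₁ ih₂ =>
    obtain ⟨h₁, h₂⟩ : i ∉ m₁.letters ∧ i ∉ m₂.letters := by
      simpa [FreeMagma.letters] using hi
    rw [map_mul, map_mul, ih₁ h₁, ih₂ h₂]

theorem fst_lift_dual {A : NAAlg F} (a : S → A.dual) (m : FreeMagma S) :
    semidirect.fst (FreeMagma.lift a m) = FreeMagma.lift (semidirect.fst ∘ a) m := by
  induction m with
  | ih1 x => rfl
  | ih2 m₁ m₂ ih₁ ih₂ => simp only [map_mul, ih₁, ih₂]

/-- The Leibniz rule: the `ε`-component is a derivation over the projection to `A`. -/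
theorem snd_lift_dual [DecidableEq S] {A : NAAlg F} (a : S → A.dual) (m : FreeMagma S)
    (hm : m.letters.Nodup) :
    semidirect.snd (FreeMagma.lift a m) = (m.letters.map fun i => FreeMagma.lift
      (Function.update (semidirect.fst ∘ a) i (semidirect.snd (a i))) m).sum := by
  induction m with
  | ih1 x => simp [FreeMagma.letters]
  | ih2 m₁ m₂ ih₁ ih₂ =>
    obtain ⟨hm₁, hm₂, hdisj⟩ : m₁.letters.Nodup ∧ m₂.letters.Nodup ∧
        Disjoint m₁.letters m₂.letters := Multiset.nodup_add.1 hm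
    have hletters : (m₁ * m₂).letters = m₁.letters + m₂.letters := rfl
    rw [map_mul, semidirect.snd_mul, ih₁ hm₁, ih₂ hm₂, fst_lift_dual, fst_lift_dual, hletters,
      Multiset.map_add, Multiset.sum_add, add_comm]
    simp only [map_mul, LinearMap.flip_apply, LinearMap.mul_apply', ← Multiset.sum_map_mul_left,
      ← Multiset.sum_map_mul_right]
    congr 2 <;> refine Multiset.map_congr rfl fun i hi => ?_
    · rw [lift_update_of_notMem _ _ m₂ (Multiset.disjoint_left.1 hdisj hi)]
    · rw [lift_update_of_notMem _ _ m₁ (Multiset.disjoint_right.1 hdisj hi)]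

theorem Satisfies.dual {A : NAAlg F} {φ : FreeNonUnitalNonAssocAlgebra F S}
    (hA : A.Satisfies φ) (hφ : IsMultilinear φ) : A.dual.Satisfies φ := by
  classical
  obtain ⟨s, hs⟩ := hφ
  intro a
  refine semidirect.ext ((map_lift semidirect.fst a φ).trans (hA _)) ?_
  have hsnd : ∀ m ∈ φ.coeff.support, semidirect.snd (FreeMagma.lift a m) =
      ∑ i ∈ s, FreeMagma.lift
        (Function.update (semidirect.fst ∘ a) i (semidirect.snd (a i))) m := fun m hm => by
    rw [snd_lift_dual a m (hs m hm ▸ s.nodup), hs m hm, Finset.sum]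
  rw [lift_eq_sum, map_sum, map_zero]
  calc ∑ m ∈ φ.coeff.support, semidirect.snd (φ.coeff m • FreeMagma.lift a m) =
      ∑ i ∈ s, ∑ m ∈ φ.coeff.support, φ.coeff m • FreeMagma.lift (Function.update
        (semidirect.fst ∘ a) i (semidirect.snd (a i))) m := by
        rw [Finset.sum_comm]
        exact Finset.sum_congr rfl fun m hm => by rw [map_smul, hsnd m hm, Finset.smul_sum]
    _ = 0 := Finset.sum_eq_zero fun i _ => hA _

variable {V : ObjectProperty (NAAlg F)}

/-- The homomorphism of algebras that underlies a morphism of a full subcategory. -/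
def toAlgHom {X Y : V.FullSubcategory} (f : X ⟶ Y) : X.obj →ₙₐ[F] Y.obj := f.hom

theorem hom_ext {X Y : V.FullSubcategory} {f g : X ⟶ Y} (h : toAlgHom f = toAlgHom g) : f = g :=
  ObjectProperty.hom_ext _ h

/-- A class of algebras closed under subalgebras, homomorphic images and products, i.e. a variety,
which is also closed under `A ↦ A[ε]`. Over an infinite field every variety is of this kind. -/
structure IsDualStableVariety (V : ObjectProperty (NAAlg F)) : Prop where
  of_injective {A B : NAAlg F} (g : A →ₙₐ[F] B) (hg : Function.Injective g) (hB : V B) : V A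
  of_surjective {A B : NAAlg F} (g : A →ₙₐ[F] B) (hg : Function.Surjective g) (hA : V A) : V B
  pi {ι : Type u} {A : ι → NAAlg F} (hA : ∀ i, V (A i)) : V ⟨∀ i, A i⟩
  dual {A : NAAlg F} (hA : V A) : V A.dual

namespace IsDualStableVariety

theorem of_isOperadicVariety (hV : IsOperadicVariety.{w} V) : IsDualStableVariety V := by
  obtain ⟨S, I, hI, rfl⟩ := hV
  exact
    { of_injective := fun g hg hB φ hφ => (hB φ hφ).of_injective g hg
      of_surjective := fun g hg hA φ hφ => (hA φ hφ).of_surjective g hg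
      pi := fun hA φ hφ => .pi fun i => hA i φ hφ
      dual := fun hA φ hφ => (hA φ hφ).dual (hI φ hφ) }

theorem of_ker_le (hV : IsDualStableVariety V) {R D E : NAAlg F} (ψ : R →ₙₐ[F] D)
    (π : R →ₙₐ[F] E) (hπ : Function.Surjective π) (hker : ∀ x, ψ x = 0 → π x = 0) (hD : V D) :
    V E := by
  let K : NonUnitalSubalgebra F (D × E) := NonUnitalAlgHom.range (ψ.prod π)
  let ι : K →ₙₐ[F] D × E := NonUnitalSubalgebraClass.subtype K
  have hK : V ⟨K⟩ := by
    refine hV.of_injective (A := ⟨K⟩) ((NonUnitalAlgHom.fst F D E).comp ι) ?_ hD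
    refine (injective_iff_map_eq_zero _).2 ?_
    rintro ⟨_, x, rfl⟩ hx
    exact Subtype.ext (Prod.ext hx (hker x hx))
  refine hV.of_surjective (A := ⟨K⟩) ((NonUnitalAlgHom.snd F D E).comp ι) (fun e => ?_) hK
  obtain ⟨x, rfl⟩ := hπ e
  exact ⟨⟨_, x, rfl⟩, rfl⟩

theorem injective_of_mono (hV : IsDualStableVariety V) {X Y : V.FullSubcategory} (f : X ⟶ Y)
    [Mono f] : Function.Injective (toAlgHom f) := by
  refine (injective_iff_map_eq_zero _).2 fun x hx => ?_
  let K : NonUnitalSubalgebra F X.obj := NonUnitalAlgHom.equalizer (toAlgHom f) 0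
  let ι : K →ₙₐ[F] X.obj := NonUnitalSubalgebraClass.subtype K
  have hK : V ⟨K⟩ := hV.of_injective (A := ⟨K⟩) ι Subtype.val_injective X.property
  have hι : (ObjectProperty.homMk ι : (⟨⟨K⟩, hK⟩ : V.FullSubcategory) ⟶ X) = 0 := by
    rw [← cancel_mono f, zero_comp]
    exact hom_ext (NonUnitalAlgHom.ext fun y => y.2)
  exact DFunLike.congr_fun (show ι = 0 from congrArg toAlgHom hι) ⟨x, hx⟩

end IsDualStableVariety

namespace semidirect

variable {B : NAAlg F} {M : Type u} [AddCommGroup M] [Module F M] {l r : B →ₗ[F] M →ₗ[F] M}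

/-- The factorization through `M` of a homomorphism to `B ⋉ M` that vanishes on `B`. -/
def kerLift {W : NAAlg F} (g : W →ₙₐ[F] B.semidirect l r) (hg : ∀ x, fst (g x) = 0) :
    W →ₙₐ[F] ofBilin (0 : M →ₗ[F] M →ₗ[F] M) :=
  homOfLinearMap (A := W) (B := ofBilin (0 : M →ₗ[F] M →ₗ[F] M))
    (snd ∘ₗ (g : W →ₗ[F] B.semidirect l r) : W →ₗ[F] M) fun x y => by
      change snd (g (x * y)) = 0
      rw [map_mul, snd_mul, hg, hg]
      simp

theorem inr_kerLift {W : NAAlg F} (g : W →ₙₐ[F] B.semidirect l r) (hg : ∀ x, fst (g x) = 0) :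
    inr.comp (kerLift g hg) = g :=
  NonUnitalAlgHom.ext fun x => ext (hg x).symm rfl

theorem inl_injective : Function.Injective (inl : B →ₙₐ[F] B.semidirect l r) :=
  LinearMap.inl_injective

theorem inr_injective :
    Function.Injective (inr : ofBilin (0 : M →ₗ[F] M →ₗ[F] M) →ₙₐ[F] B.semidirect l r) :=
  fun _ _ h => congrArg (snd (l := l) (r := r)) h

/-- The split extension `M ⟶ B ⋉ M ⇄ B` in a class of algebras `V`. -/
def splitExtension (hM : V (ofBilin (0 : M →ₗ[F] M →ₗ[F] M))) (hB : V B)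
    (hA : V (B.semidirect l r)) : SplitExtension (C := V.FullSubcategory) ⟨_, hM⟩ where
  A := ⟨_, hA⟩
  B := ⟨_, hB⟩
  k := ObjectProperty.homMk inr
  α := ObjectProperty.homMk fst
  β := ObjectProperty.homMk inl
  section_proj := rfl
  zero := rfl
  isKernel := by
    have fst_eq_zero {W : V.FullSubcategory} (g : W.obj →ₙₐ[F] B.semidirect l r)
        (hg : fst.comp g = 0) : ∀ x, fst (g x) = 0 := DFunLike.congr_fun hg
    refine ⟨KernelFork.IsLimit.ofι _ _
      (fun g hg => ObjectProperty.homMk <|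
        kerLift (toAlgHom g) (fst_eq_zero _ (congrArg toAlgHom hg)))
      (fun g hg => hom_ext <|
        inr_kerLift (toAlgHom g) (fst_eq_zero _ (congrArg toAlgHom hg))) fun g hg m hm => ?_⟩
    have hm' : inr.comp (toAlgHom m) = toAlgHom g := congrArg toAlgHom hm
    exact hom_ext <| NonUnitalAlgHom.ext fun x =>
      congrArg (snd (l := l) (r := r)) (DFunLike.congr_fun hm' x)

end semidirect

section Accessible

open semidirect

variable {B : NAAlg F} {M : Type u} [AddCommGroup M] [Module F M] {l r : B →ₗ[F] M →ₗ[F] M}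
  {hM : V (ofBilin (0 : M →ₗ[F] M →ₗ[F] M))} {hB : V B} {hA : V (B.semidirect l r)}

namespace IsDualStableVariety

theorem action_eq_zero_of_hom_g_eq_zero (hV : IsDualStableVariety V)
    {E : SplitExtension (C := V.FullSubcategory) ⟨_, hM⟩}
    (h : (splitExtension hM hB hA).Hom E) {b : B}
    (hb : toAlgHom h.g b = 0) : l b = 0 := by
  let f : B.semidirect l r →ₙₐ[F] E.A.obj := toAlgHom h.f
  let k : ofBilin 0 →ₙₐ[F] E.A.obj := toAlgHom E.k
  let β : E.B.obj →ₙₐ[F] E.A.obj := toAlgHom E.β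
  have hfk (m : M) : f (inr m) = k m :=
    DFunLike.congr_fun (congrArg toAlgHom h.comm_k : f.comp inr = k) m
  have hfβ : f (inl b) = β (toAlgHom h.g b) :=
    DFunLike.congr_fun (congrArg toAlgHom h.comm_β : f.comp inl = β.comp (toAlgHom h.g)) b
  have hk : Function.Injective k :=
    haveI : Mono E.k := mono_of_isLimit_fork E.isKernel.some
    hV.injective_of_mono E.k
  refine LinearMap.ext fun m => hk ?_
  calc k (l b m) = f (inl b * inr m) := by rw [inl_mul_inr, hfk]
    _ = k 0 := by rw [map_mul, hfβ, hb, map_zero, zero_mul, map_zero]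

theorem hom_g_eq_zero_of_isFaithful (hV : IsDualStableVariety V)
    {E : SplitExtension (C := V.FullSubcategory) ⟨_, hM⟩} (hE : E.IsFaithful)
    (h : (splitExtension hM hB hA).Hom E) (S : NonUnitalSubalgebra F B)
    (hl : ∀ s ∈ S, l s = 0) (hr : ∀ s ∈ S, r s = 0) {s : B} (hs : s ∈ S) :
    toAlgHom h.g s = 0 := by
  let ι : S →ₙₐ[F] B := NonUnitalSubalgebraClass.subtype S
  let j : semidirect ⟨S⟩ 0 0 →ₙₐ[F] B.semidirect l r :=
    map (B := ⟨S⟩) ι LinearMap.id (fun s m => by simp [ι, hl s s.2])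
      fun s m => by simp [ι, hr s s.2]
  let p : semidirect ⟨S⟩ 0 0 →ₙₐ[F] B.semidirect l r :=
    map (B := ⟨S⟩) 0 LinearMap.id (fun s m => by simp) fun s m => by simp
  have hS : V ⟨S⟩ := hV.of_injective (A := ⟨S⟩) ι Subtype.val_injective hB
  have hSM : V (semidirect ⟨S⟩ (0 : S →ₗ[F] M →ₗ[F] M) 0) :=
    hV.of_injective j (Subtype.val_injective.prodMap Function.injective_id) hA
  let E₀ : SplitExtension (C := V.FullSubcategory) ⟨_, hM⟩ := splitExtension hM hS hSM
  let incl : E₀.Hom (splitExtension hM hB hA) :=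
    { f := ObjectProperty.homMk j
      g := ObjectProperty.homMk ι
      comm_k := rfl
      comm_α := rfl
      comm_β := rfl }
  let proj : E₀.Hom (splitExtension hM hB hA) :=
    { f := ObjectProperty.homMk p
      g := 0
      comm_k := rfl
      comm_α := rfl
      comm_β := rfl }
  have hg : (toAlgHom h.g).comp ι = (toAlgHom h.g).comp 0 :=
    congrArg toAlgHom (hE.comp_g_eq incl proj h)
  exact (DFunLike.congr_fun hg ⟨s, hs⟩).trans (map_zero (toAlgHom h.g))

theorem action_mul_eq_zero (hV : IsDualStableVariety V)
    (hacc : IsActionAccessible V.FullSubcategory) (hA : V (B.semidirect l r))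
    (S : NonUnitalSubalgebra F B) (hl : ∀ s ∈ S, l s = 0) (hr : ∀ s ∈ S, r s = 0)
    {s : B} (hs : s ∈ S) (b : B) : l (s * b) = 0 := by
  have hM : V (ofBilin (0 : M →ₗ[F] M →ₗ[F] M)) := hV.of_injective inr inr_injective hA
  have hB : V B := hV.of_injective inl inl_injective hA
  obtain ⟨E, hE, ⟨h⟩⟩ := hacc ⟨_, hM⟩ (splitExtension hM hB hA)
  refine hV.action_eq_zero_of_hom_g_eq_zero h ?_
  let g : B →ₙₐ[F] E.B.obj := toAlgHom h.g
  have hgs : g s = 0 := hV.hom_g_eq_zero_of_isFaithful hE h S hl hr hs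
  calc g (s * b) = g s * g b := map_mul g s b
    _ = 0 := by rw [hgs, zero_mul]

end IsDualStableVariety

end Accessible

variable {σ : F}

/-- `x y = σ y x`: commutativity for `σ = 1`, anti-commutativity for `σ = -1`. -/
def SkewCom (σ : F) : ObjectProperty (NAAlg F) :=
  fun A => ∀ x y : A, x * y = σ • (y * x)

variable (F) in
theorem skewCom_one : SkewCom (1 : F) = Com F := by
  ext A
  simp only [SkewCom, Com, one_smul]

variable (F) in
theorem skewCom_neg_one : SkewCom (-1 : F) = ACom F := by
  ext A
  simp only [SkewCom, ACom, neg_one_smul]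

/-- The algebra with basis `a`, `b`, `d` whose only non-zero products of basis vectors are
`a b = d` and `b a = σ d`. -/
def pairAlg (σ : F) : NAAlg F :=
  ofBilin (M := Fin 3 → F) <| LinearMap.mk₂ F
    (fun u v => ![0, 0, u 0 * v 1 + σ * (u 1 * v 0)])
    (fun _ _ _ => by ext i; fin_cases i <;> simp; ring)
    (fun _ _ _ => by ext i; fin_cases i <;> simp; ring)
    (fun _ _ _ => by ext i; fin_cases i <;> simp; ring)
    (fun _ _ _ => by ext i; fin_cases i <;> simp; ring)

namespace pairAlg

/-- The coordinates of an element of `pairAlg σ` with respect to the basis `a`, `b`, `d`. -/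
def coord : pairAlg σ ≃ₗ[F] (Fin 3 → F) := LinearEquiv.refl F (Fin 3 → F)

theorem coord_mul (x y : pairAlg σ) :
    coord (x * y) = ![0, 0, coord x 0 * coord y 1 + σ * (coord x 1 * coord y 0)] := rfl

variable (σ)

/-- The action of `pairAlg σ` on the space with basis `c`, `d c`, in which `a` and `b` act
trivially. -/
def productAction : pairAlg σ →ₗ[F] (Fin 2 → F) →ₗ[F] (Fin 2 → F) :=
  LinearMap.mk₂ F (fun x m => ![0, coord x 2 * m 0])
    (fun _ _ _ => by ext i; fin_cases i <;> simp [add_mul])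
    (fun _ _ _ => by ext i; fin_cases i <;> simp [mul_assoc])
    (fun _ _ _ => by ext i; fin_cases i <;> simp [mul_add])
    (fun _ _ _ => by ext i; fin_cases i <;> simp [mul_left_comm])

/-- The action of `pairAlg σ` on the space with basis `c`, `a c`, `b c`, `d c`, `a (b c)`,
`b (a c)`, in which all products of a basis vector with `a`, `b` or `d` that do not occur in this
list vanish. -/
def wordAction : pairAlg σ →ₗ[F] (Fin 6 → F) →ₗ[F] (Fin 6 → F) :=
  LinearMap.mk₂ F (fun x m => ![0, coord x 0 * m 0, coord x 1 * m 0, coord x 2 * m 0,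
      coord x 0 * m 2, coord x 1 * m 1])
    (fun _ _ _ => by ext i; fin_cases i <;> simp [add_mul])
    (fun _ _ _ => by ext i; fin_cases i <;> simp [mul_assoc])
    (fun _ _ _ => by ext i; fin_cases i <;> simp [mul_add])
    (fun _ _ _ => by ext i; fin_cases i <;> simp [mul_left_comm])

/-- The line spanned by `a`, as a subalgebra of `pairAlg σ`. -/
def line : NonUnitalSubalgebra F (pairAlg σ) where
  carrier := {x | coord x 1 = 0 ∧ coord x 2 = 0}
  add_mem' := by
    rintro x y ⟨hx₁, hx₂⟩ ⟨hy₁, hy₂⟩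
    simp [hx₁, hx₂, hy₁, hy₂]
  zero_mem' := by simp
  smul_mem' := by
    rintro t x ⟨hx₁, hx₂⟩
    simp [hx₁, hx₂]
  mul_mem' := by
    rintro x y ⟨hx₁, -⟩ ⟨hy₁, -⟩
    simp [coord_mul, hx₁, hy₁]

end pairAlg

open pairAlg

theorem IsDualStableVariety.not_semidirect_productAction (hV : IsDualStableVariety V)
    (hacc : IsActionAccessible V.FullSubcategory) (σ : F) :
    ¬ V ((pairAlg σ).semidirect (productAction σ) (σ • productAction σ)) := by
  intro hT
  have hl (s) (hs : s ∈ line σ) : productAction σ s = 0 := by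
    ext m i
    fin_cases i <;> simp [productAction, hs.2]
  let a : pairAlg σ := coord.symm ![1, 0, 0]
  let b : pairAlg σ := coord.symm ![0, 1, 0]
  have ha : a ∈ line σ := ⟨by simp [a], by simp [a]⟩
  have hab : productAction σ (a * b) ![1, 0] 1 = 1 := by
    simp [productAction, coord_mul, a, b]
  have h := hV.action_mul_eq_zero hacc hT (line σ) hl
      (fun s hs => by rw [LinearMap.smul_apply, hl s hs, smul_zero]) ha b
  rw [h] at hab
  exact zero_ne_one hab

section Words

variable {A : NAAlg F}

/-- The identification of `((x₀, x₁), (x₂, x₃))` with the element `x₀ + x₁ ε₁ + x₂ ε₂ + x₃ ε₁ ε₂`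
of `A[ε₁][ε₂]`. -/
def dualDualEquiv : ((A × A) × A × A) ≃ₗ[F] A.dual.dual := LinearEquiv.refl F _

theorem dualDualEquiv_mul (x₀ x₁ x₂ x₃ y₀ y₁ y₂ y₃ : A) :
    dualDualEquiv ((x₀, x₁), (x₂, x₃)) * dualDualEquiv ((y₀, y₁), (y₂, y₃)) =
      dualDualEquiv ((x₀ * y₀, x₀ * y₁ + x₁ * y₀), (x₀ * y₂ + x₂ * y₀,
        x₀ * y₃ + x₁ * y₂ + (x₂ * y₁ + x₃ * y₀))) := rfl

/-- The homomorphism to `A[ε₁][ε₂]` that sends the basis to `a ε₁`, `b ε₂`, `a b ε₁ ε₂`. -/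
def pairHom (a b : A) (h : b * a = σ • (a * b)) : pairAlg σ →ₙₐ[F] A.dual.dual where
  toFun x := dualDualEquiv ((0, coord x 0 • a), (coord x 1 • b, coord x 2 • (a * b)))
  map_smul' t x := by simp [← map_smul dualDualEquiv, smul_smul]
  map_zero' := by simp [← Prod.zero_eq_mk]
  map_add' x y := by simp [← map_add dualDualEquiv, add_smul]
  map_mul' x y := by
    simp [dualDualEquiv_mul, coord_mul, h, add_smul, smul_smul, smul_mul_smul_comm, mul_comm]

/-- The map to `A[ε₁][ε₂]` that sends the basis to `c`, `a c ε₁`, `b c ε₂`, `(a b) c ε₁ ε₂`,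
`a (b c) ε₁ ε₂`, `b (a c) ε₁ ε₂`. -/
def wordEval (a b c : A) : (Fin 6 → F) →ₗ[F] A.dual.dual where
  toFun m := dualDualEquiv ((m 0 • c, m 1 • (a * c)),
    (m 2 • (b * c), m 3 • (a * b * c) + m 4 • (a * (b * c)) + m 5 • (b * (a * c))))
  map_smul' t m := by simp [← map_smul, smul_smul]
  map_add' m n := by
    simp only [← map_add, Pi.add_apply, add_smul, Prod.mk_add_mk]
    congr 3
    abel

theorem wordEval_wordAction (a b c : A) (h : b * a = σ • (a * b)) (x : pairAlg σ)
    (m : Fin 6 → F) :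
    wordEval a b c (wordAction σ x m) = pairHom a b h x * wordEval a b c m := by
  simp [wordEval, pairHom, wordAction, dualDualEquiv_mul, smul_mul_smul_comm]
  abel

theorem eq_zero_of_pairHom_eq_zero {a b : A} {h : b * a = σ • (a * b)} (hab : a * b ≠ 0)
    {x : pairAlg σ} (hx : pairHom a b h x = 0) : x = 0 := by
  have hcoord : coord x 0 • a = 0 ∧ coord x 1 • b = 0 ∧ coord x 2 • (a * b) = 0 := by
    simpa [pairHom] using hx
  have ha : a ≠ 0 := left_ne_zero_of_mul hab
  have hb : b ≠ 0 := right_ne_zero_of_mul hab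
  refine coord.map_eq_zero_iff.1 (funext fun i => ?_)
  fin_cases i
  · exact (smul_eq_zero.1 hcoord.1).resolve_right ha
  · exact (smul_eq_zero.1 hcoord.2.1).resolve_right hb
  · exact (smul_eq_zero.1 hcoord.2.2).resolve_right hab

theorem eq_zero_of_wordEval_eq_zero {a b c : A}
    (hspan : a * b * c ∉ Submodule.span F {a * (b * c), b * (a * c)}) {m : Fin 6 → F}
    (hm : wordEval a b c m = 0) : m 0 = 0 ∧ m 3 = 0 := by
  have hcoord : (m 0 • c = 0 ∧ m 1 • (a * c) = 0) ∧ m 2 • (b * c) = 0 ∧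
      m 3 • (a * b * c) + m 4 • (a * (b * c)) + m 5 • (b * (a * c)) = 0 := by
    simpa only [wordEval, LinearMap.coe_mk, AddHom.coe_mk, LinearEquiv.map_eq_zero_iff,
      Prod.mk_eq_zero] using hm
  have hc : c ≠ 0 := fun hc => hspan (by simp [hc])
  refine ⟨(smul_eq_zero.1 hcoord.1.1).resolve_right hc, ?_⟩
  by_contra hm₃
  refine hspan (Submodule.mem_span_pair.2 ⟨-(m 3)⁻¹ * m 4, -(m 3)⁻¹ * m 5, ?_⟩)
  linear_combination (norm := (match_scalars <;> field_simp <;> ring)) (-(m 3)⁻¹) • hcoord.2.2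

/-- The subalgebra of `A[ε₁][ε₂][ε₃]` spanned by `a ε₁`, `b ε₂`, `a b ε₁ ε₂` and by the multiples by
`ε₃` of the words in `wordEval` maps onto `pairAlg σ ⋉ ⟨c, d c⟩`, because the relations between
these elements do not involve `(a b) c ε₁ ε₂ ε₃`. -/
theorem IsDualStableVariety.semidirect_productAction (hV : IsDualStableVariety V)
    (hσ : V ≤ SkewCom σ) (hA : V A) {a b c : A}
    (hspan : a * b * c ∉ Submodule.span F {a * (b * c), b * (a * c)}) :
    V ((pairAlg σ).semidirect (productAction σ) (σ • productAction σ)) := by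
  let D : NAAlg F := A.dual.dual
  have hD : V D := hV.dual (hV.dual hA)
  have hab : a * b ≠ 0 := fun hab => hspan (by simp [hab])
  let φ : pairAlg σ →ₙₐ[F] D := pairHom a b (hσ A hA b a)
  let ψ : (pairAlg σ).semidirect (wordAction σ) (σ • wordAction σ) →ₙₐ[F] D.dual :=
    semidirect.map φ (wordEval a b c) (wordEval_wordAction a b c _) fun x m => by
      change wordEval a b c (σ • wordAction σ x m) = wordEval a b c m * φ x
      rw [map_smul, wordEval_wordAction a b c (hσ A hA b a), hσ D hD (wordEval a b c m)]
  let π : (pairAlg σ).semidirect (wordAction σ) (σ • wordAction σ) →ₙₐ[F]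
      (pairAlg σ).semidirect (productAction σ) (σ • productAction σ) :=
    semidirect.map (NonUnitalAlgHom.id F _) (LinearMap.funLeft F F ![0, 3])
      (fun x m => by ext i; fin_cases i <;> simp [wordAction, productAction, LinearMap.funLeft])
      fun x m => by ext i; fin_cases i <;> simp [wordAction, productAction, LinearMap.funLeft]
  refine hV.of_ker_le ψ π ?_ (fun x hx => semidirect.ext ?_ ?_) (hV.dual hD)
  · exact Function.surjective_id.prodMap
      (LinearMap.funLeft_surjective_of_injective F F _ (by decide))
  · exact eq_zero_of_pairHom_eq_zero (h := hσ A hA b a) hab (congrArg semidirect.fst hx)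
  · have hx := eq_zero_of_wordEval_eq_zero hspan (congrArg semidirect.snd hx)
    refine funext fun i => ?_
    fin_cases i
    exacts [hx.1, hx.2]

end Words

variable {s t : F}

namespace IsDualStableVariety

theorem mul_mul_mem_span (hV : IsDualStableVariety V) (hacc : IsActionAccessible V.FullSubcategory)
    (hσ : V ≤ SkewCom σ) {A : NAAlg F} (hA : V A) (a b c : A) :
    a * b * c ∈ Submodule.span F {a * (b * c), b * (a * c)} := by
  by_contra hspan
  exact hV.not_semidirect_productAction hacc σ (hV.semidirect_productAction hσ hA hspan)

theorem exists_forall_mul_mul_eq (hV : IsDualStableVariety V)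
    (hacc : IsActionAccessible V.FullSubcategory) (hσ : V ≤ SkewCom σ) :
    ∃ s t : F, ∀ A, V A → ∀ a b c : A, a * b * c = s • (a * (b * c)) + t • (b * (a * c)) := by
  by_contra! h
  choose A hA a b c habc using h
  let P : NAAlg F := ⟨∀ p : F × F, A p.1 p.2⟩
  have hP : V P := hV.pi fun p => hA p.1 p.2
  obtain ⟨s, t, hst⟩ := Submodule.mem_span_pair.1 <| hV.mul_mul_mem_span hacc hσ hP
    (fun p => a p.1 p.2) (fun p => b p.1 p.2) fun p => c p.1 p.2
  exact habc s t (congrFun hst (s, t)).symm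

end IsDualStableVariety

section Cyclic

variable {A : NAAlg F}

theorem SkewCom.mul_mul_eq_add (hA : SkewCom σ A) (hσσ : σ * σ = 1)
    (h : ∀ a b c : A, a * b * c = s • (a * (b * c)) + t • (b * (a * c))) (a b c : A) :
    a * b * c = (s * σ) • (b * c * a) + t • (c * a * b) := by
  rw [h, hA a (b * c), hA b (a * c), hA a c, smul_mul_assoc, smul_smul, smul_smul σ σ, hσσ,
    one_smul]

theorem SkewCom.mul_mul_eq_add_swap (hA : SkewCom σ A) (hσσ : σ * σ = 1)
    (h : ∀ a b c : A, a * b * c = s • (a * (b * c)) + t • (b * (a * c))) (a b c : A) :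
    a * b * c = t • (b * c * a) + (s * σ) • (c * a * b) := by
  calc a * b * c = σ • (b * a * c) := by rw [hA a b, smul_mul_assoc]
    _ = σ • ((s * σ) • (a * c * b) + t • (c * b * a)) := by
      rw [hA.mul_mul_eq_add hσσ h b a c]
    _ = (σ * σ) • (t • (b * c * a) + (s * σ) • (c * a * b)) := by
      rw [hA a c, hA c b, smul_mul_assoc, smul_mul_assoc]
      module
    _ = t • (b * c * a) + (s * σ) • (c * a * b) := by rw [hσσ, one_smul]

end Cyclic

/-- The two expressions of `(a b) c` through `(b c) a` and `(c a) b` that result from the identity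
and its image under `a ↔ b` differ by a multiple of `(b c) a - (c a) b`; when they coincide,
comparing the cyclic rotations of the identity leaves the two cases. -/
theorem IsDualStableVariety.forall_cyclic_or_forall_jacobi (hV : IsDualStableVariety V)
    (hacc : IsActionAccessible V.FullSubcategory) (hσ : V ≤ SkewCom σ) (hσσ : σ * σ = 1) :
    (∀ A, V A → ∀ a b c : A, a * b * c = b * c * a) ∨
      ∀ A, V A → ∀ a b c : A, a * b * c + b * c * a + c * a * b = 0 := by
  obtain ⟨s, t, h⟩ := hV.exists_forall_mul_mul_eq hacc hσ
  have h₁ (A) (hA : V A) (a b c : A) : a * b * c = (s * σ) • (b * c * a) + t • (c * a * b) :=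
    (hσ A hA).mul_mul_eq_add hσσ (h A hA) a b c
  have h₂ (A) (hA : V A) (a b c : A) : a * b * c = t • (b * c * a) + (s * σ) • (c * a * b) :=
    (hσ A hA).mul_mul_eq_add_swap hσσ (h A hA) a b c
  by_cases hst : s * σ = t
  · by_cases ht : 1 + t = 0
    · refine .inr fun A hA a b c => ?_
      have ht : t = -1 := by linear_combination ht
      have habc := h₁ A hA a b c
      rw [hst, ht] at habc
      rw [habc]
      module
    · refine .inl fun A hA a b c => sub_eq_zero.1 ((smul_eq_zero.1 ?_).resolve_left ht)
      have habc := h₁ A hA a b c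
      have hbca := h₁ A hA b c a
      rw [hst] at habc hbca
      linear_combination (norm := module) habc - hbca
  · refine .inl fun A hA a b c =>
      sub_eq_zero.1 ((smul_eq_zero.1 ?_).resolve_left (sub_ne_zero.2 hst))
    linear_combination (norm := module) h₂ A hA c a b - h₁ A hA c a b

end NAAlg

open NAAlg

theorem mainTheorem8_general {F : Type u} [Field F] {V : ObjectProperty (NAAlg F)}
    (hV : IsDualStableVariety V) (hacc : IsActionAccessible V.FullSubcategory) :
    (V ≤ Com F → V ≤ CAssoc F ∨ V ≤ JJord F) ∧
      (V ≤ ACom F → V ≤ LieVar F ∨ V ≤ ACAAssoc F) := by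
  refine ⟨fun hcom => ?_, fun hacom => ?_⟩
  · rcases hV.forall_cyclic_or_forall_jacobi hacc ((skewCom_one F).symm ▸ hcom) (one_mul 1)
      with hcyclic | hjacobi
    · exact .inl fun A hA => ⟨hcom A hA, fun x y z => by rw [hcyclic A hA x y z, hcom A hA x]⟩
    · refine .inr fun A hA => ⟨hcom A hA, fun x y z => ?_⟩
      rw [hcom A hA x (y * z), hcom A hA y (z * x), hcom A hA z (x * y), hjacobi A hA y z x]
  · rcases hV.forall_cyclic_or_forall_jacobi hacc ((skewCom_neg_one F).symm ▸ hacom) (by simp)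
      with hcyclic | hjacobi
    · exact .inr fun A hA => ⟨hacom A hA, fun x y z => by rw [hcyclic A hA x y z, hacom A hA x]⟩
    · refine .inl fun A hA => ⟨fun x y => by rw [hacom A hA x y, neg_add_cancel], fun x y z => ?_⟩
      rw [hacom A hA x (y * z), hacom A hA y (z * x), hacom A hA z (x * y), ← neg_add, ← neg_add,
        hjacobi A hA y z x, neg_zero]

theorem mainTheorem8 {F : Type u} [Field F] (V : ObjectProperty (NAAlg F))
    (hOperadic : IsOperadicVariety.{w} V)
    (hNonAbelian : V ≠ AbAlg F)
    (hAccessible : IsActionAccessible V.FullSubcategory) :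
    (V ≤ Com F → V ≤ CAssoc F ∨ V ≤ JJord F) ∧
      (V ≤ ACom F → V ≤ LieVar F ∨ V ≤ ACAAssoc F) :=
  mainTheorem8_general (.of_isOperadicVariety hOperadic) hAccessible
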